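/- Graphs are simple; for a vertex $v$ of a graph $G$, $G[v]$ is its set of neighbours. A ray is a one-way infinite path; two rays are tail-equivalent if they share a common tail. We say that $G[v]$ contains a ray if the subgraph of $G$ induced on $G[v]$ contains a ray. Let $\mathcal G$ be the class of all graphs $G$ such that for every vertex $v$ the subgraph of $G$ induced on $G[v]$ has at most one ray up to tail-equivalence, and let $\mathcal G_\lambda$ be the class of the members of $\mathcal G$ with exactly $\lambda$ vertices. A subgraph $H\in\mathcal G_\lambda$ of $G\in\mathcal G_\lambda$ (not necessarily induced) is an $r$-subgraph of $G$ if for every vertex $v$ of $H$: if $G[v]$ contains a ray (of $G$), then $H[v]$ contains a ray (of $H$). Let $\lambda>\aleph_1$ be a regular cardinal and let $\bar C=\langle c_\delta:\delta\in S\rangle$ be a club guessing sequence on $\lambda$: $S\subseteq\lambda$ is stationary, each $c_\delta\subseteq\delta$ has order type $\omega$ and supremum $\delta$, and for every club $E\subseteq\lambda$ the set $\{\delta\in S: c_\delta\subseteq E\}$ is stationary. Let $\alpha^\delta_0<\alpha^\delta_1<\cdots$ be the increasing enumeration of $c_\delta$. Let $I=\mathrm{id}^b(\bar C)$ be the ideal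 of all $X\subseteq\lambda$ for which there is a club $E\subseteq\lambda$ such that for no $\delta\in X\cap S\cap E$ an end segment of $c_\delta$ is contained in $E$. For $G\in\mathcal G_\lambda$ choose a bijection $h$ from the vertex set of $G$ onto $\lambda$, and a function $r$ such that $r(v)$ is (the vertex set of) a ray in the subgraph induced on $G[v]$ if there is one, and $r(v)=\emptyset$ otherwise. Put $G^\alpha=\{v: h(v)<\alpha\}$ and, for $\delta\in S$, $$\varphi(v,\delta)=\big[\{n<\omega : r(v)\cap G^{\alpha^\delta_n}\subsetneq r(v)\cap G^{\alpha^\delta_{n+1}}\}\big]_{\mathrm{fin}}\in\mathcal P(\omega)/\mathrm{fin},\qquad \varphi(G,\delta)=\{\varphi(v,\delta): v\in G\},$$ $$\Phi(G)=\big\{A\in \mathcal P(\omega)/\mathrm{fin} : \{\delta\in S: A\in\varphi(G,\delta)\}\notin I\big\}.$$ **Claim 2.2 (Continuity).** Let $G\in\mathcal G_\lambda$, and let $(G_\alpha)_{\alpha<\beta}$, with $\beta<\lambda$, be $r$-subgraphs of $G$ such that every vertex of $G$ belongs to some $G_\alpha$ (in particular this holds if $G=\bigcup_{\alpha<\beta}G_\alpha$).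 Then $$\Phi(G)=\bigcup_{\alpha<\beta}\Phi(G_\alpha),$$ where $\Phi(G)$ and each $\Phi(G_\alpha)$ may be computed with arbitrary choices of the parameters $h,r$ for the respective graph. -/

import Mathlib

universe u

namespace RayGraph

open Cardinal

section Rays

variable {V : Type u}

/-- A ray (one-way infinite path) of `G`, given by the sequence of its vertices. -/
def IsRay (G : SimpleGraph V) (x : ℕ → V) : Prop :=
  Function.Injective x ∧ ∀ n, G.Adj (x n) (x (n + 1))

/-- A ray in the subgraph of `G` induced on the neighbourhood `G[v]`. -/
def IsNbhdRay (G : SimpleGraph V) (v : V) (x : ℕ → V) : Prop :=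
  IsRay G x ∧ ∀ n, x n ∈ G.neighborSet v

/-- The neighbourhood of `v` in `G` contains a ray. -/
def HasNbhdRay (G : SimpleGraph V) (v : V) : Prop :=
  ∃ x, IsNbhdRay G v x

/-- Two rays share a common tail: after deleting finite initial segments they coincide. -/
def TailEquiv (x y : ℕ → V) : Prop :=
  ∃ m k : ℕ, ∀ n, x (m + n) = y (k + n)

/-- `G` belongs to the class `𝒢`: each neighbourhood has at most one ray up to tail-equivalence. -/
def InClass (G : SimpleGraph V) : Prop :=
  ∀ (v : V) (x y : ℕ → V), IsNbhdRay G v x → IsNbhdRay G v y → TailEquiv x y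

/-- `G` belongs to `𝒢_κ`: it belongs to `𝒢` and has exactly `κ` vertices. -/
def InClassCard (κ : Cardinal.{u}) (G : SimpleGraph V) : Prop :=
  InClass G ∧ #V = κ

/-- `H` is an `r`-subgraph of `G`: for every vertex `v` of `H`, if `G[v]` contains a ray
(of `G`), then `H[v]` contains a ray (of `H`). -/
def IsRSubgraph {G : SimpleGraph V} (H : G.Subgraph) : Prop :=
  ∀ v : H.verts, HasNbhdRay G v → HasNbhdRay H.coe v

end Rays

section ReducedPowerSet

/-- Equivalence modulo `fin` of sets of natural numbers. -/
def finSetoid : Setoid (Set ℕ) where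
  r X Y := (symmDiff X Y).Finite
  iseqv :=
    { refl := fun X => by simp
      symm := fun {X Y} h => by rwa [symmDiff_comm]
      trans := fun {X Y Z} h₁ h₂ => (h₁.union h₂).subset (symmDiff_triangle X Y Z) }

/-- The quotient `𝒫(ω)/fin`. -/
def PowModFin : Type := Quotient finSetoid

/-- The class modulo `fin` of a set of natural numbers. -/
def modFin (X : Set ℕ) : PowModFin := Quotient.mk finSetoid X

end ReducedPowerSet

section Guessing

/-- A club guessing sequence `⟨c_δ : δ ∈ S⟩` on `κ` with `otp c_δ = ω`. The ordinals below `κ` are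
the elements of `κ.ord.ToType`; for `δ ∈ S` the set `c_δ` is given by its increasing enumeration
`c δ 0 < c δ 1 < ⋯` (the values of `c` outside `S` are irrelevant). -/
structure ClubGuessing (κ : Cardinal.{u}) where
  /-- The set of indices. -/
  S : Set κ.ord.ToType
  /-- The increasing enumeration of `c_δ`. -/
  c : κ.ord.ToType → ℕ → κ.ord.ToType
  stationary : IsStationary S
  strictMono : ∀ δ ∈ S, StrictMono (c δ)
  isLUB : ∀ δ ∈ S, IsLUB (Set.range (c δ)) δ
  guess : ∀ E : Set κ.ord.ToType, IsClub E → IsStationary {δ | δ ∈ S ∧ ∀ n, c δ n ∈ E}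

/-- The guessing ideal `id^b(C)`: `X` belongs to it iff there is a club `E` such that for no
`δ ∈ X ∩ S ∩ E` an end segment of `c_δ` is contained in `E`. -/
def ClubGuessing.idb {κ : Cardinal.{u}} (C : ClubGuessing κ) : Set (Set κ.ord.ToType) :=
  {X | ∃ E : Set κ.ord.ToType, IsClub E ∧
    ∀ δ ∈ X ∩ C.S ∩ E, ¬ ∃ m : ℕ, ∀ n, m ≤ n → C.c δ n ∈ E}

end Guessing

section Invariant

variable {V : Type u}

/-- The auxiliary parameters on `G`: an enumeration `h` of the vertices in order type `κ`, and a
function `r` choosing (the vertex set of) a ray in `G[v]` if there is one, and `∅` otherwise. -/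
structure Parameters (κ : Cardinal.{u}) (G : SimpleGraph V) where
  /-- The enumeration of the vertices. -/
  h : V ≃ κ.ord.ToType
  /-- The chosen ray. -/
  r : V → Set V
  r_ray : ∀ v, HasNbhdRay G v → ∃ x, IsNbhdRay G v x ∧ r v = Set.range x
  r_empty : ∀ v, ¬ HasNbhdRay G v → r v = ∅

variable {κ : Cardinal.{u}} {G : SimpleGraph V}

/-- The initial segment `G^α` of the enumeration. -/
def Parameters.initial (P : Parameters κ G) (α : κ.ord.ToType) : Set V :=
  {v | P.h v < α}

/-- `φ(v, δ)`: the class modulo `fin` of the set of those `n` for which the ray `r(v)` has a vertex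
in `G^{α_{n+1}}` outside `G^{α_n}`, where `α_0 < α_1 < ⋯` enumerates `c_δ`. -/
def Parameters.phiVertex (P : Parameters κ G) (C : ClubGuessing κ) (v : V) (δ : κ.ord.ToType) :
    PowModFin :=
  modFin {n | P.r v ∩ P.initial (C.c δ n) ⊂ P.r v ∩ P.initial (C.c δ (n + 1))}

/-- `φ(G, δ)`, the set of all `φ(v, δ)`. -/
def Parameters.phi (P : Parameters κ G) (C : ClubGuessing κ) (δ : κ.ord.ToType) :
    Set PowModFin :=
  Set.range fun v => P.phiVertex C v δ

/-- `Φ(G)`, computed with the parameters `P` on `G`: the set of those elements of `𝒫(ω)/fin` which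
belong to `φ(G, δ)` for a set of coordinates `δ ∈ S` that is positive for `id^b(C)`. -/
def Parameters.Phi (P : Parameters κ G) (C : ClubGuessing κ) : Set PowModFin :=
  {A | {δ | δ ∈ C.S ∧ A ∈ P.phi C δ} ∉ C.idb}

end Invariant

end RayGraph

namespace RayGraph

open Cardinal Order Set

section Club

variable {α : Type u} [LinearOrder α]

/-! Let `v` lie in an `r`-subgraph `H`. The rays chosen at `v` in `H` and in `G` are both rays of
`G[v]`, hence tail-equivalent, so they differ in finitely many vertices. The enumerations of `H` and
`G` cut `H` into the same initial segments on a club. If this club contains an end segment of `c_δ`,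
the two values of `φ(v, δ)` agree modulo `fin` (`phiVertex_coe_eq`). The ideal ignores all other `δ`
(`mem_idb_of_eventually`), and it is closed under unions of fewer than `κ` sets (`iUnion_mem_idb`).
-/

theorem exists_forall_lt_of_mk_lt_cof {s : Set α} (hs : #s < cof α) : ∃ b, ∀ x ∈ s, x < b := by
  have h : ¬ IsCofinal s := fun h => (cof_le h).not_gt hs
  rwa [not_isCofinal_iff] at h

variable [WellFoundedLT α]

/-- The points closed under a function form a club. -/
theorem isClub_setOf_forall_lt (hα : ℵ₀ < cof α) (hα' : ∀ a : α, #(Iio a) < cof α) (F : α → α) :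
    IsClub {a | ∀ b < a, F b < a} := by
  refine ⟨fun t ht _ _ a ha b hb => ?_, fun a => ?_⟩
  · obtain ⟨c, hc, hbc⟩ := (lt_isLUB_iff ha).1 hb
    exact (ht hc b hbc).trans_le (ha.1 hc)
  · have step (x : α) : ∃ y, x < y ∧ ∀ b < x, F b < y := by
      obtain ⟨y, hy⟩ := exists_forall_lt_of_mk_lt_cof (mk_image_le.trans_lt (hα' x) :
        #(F '' Iio x) < cof α)
      obtain ⟨z, hz⟩ := exists_forall_lt_of_mk_lt_cof (s := {x, y})
        (((Set.toFinite _).lt_aleph0).trans hα)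
      exact ⟨z, hz x (by simp), fun b hb => (hy _ ⟨b, hb, rfl⟩).trans (hz y (by simp))⟩
    choose g hg hgF using step
    let u : ℕ → α := fun n => g^[n] a
    have hu (n : ℕ) : u (n + 1) = g (u n) := Function.iterate_succ_apply' g n a
    have hbdd : ∃ b, ∀ n, u n < b := by
      obtain ⟨b, hb⟩ := exists_forall_lt_of_mk_lt_cof (s := range u)
        (((countable_range u).le_aleph0).trans_lt hα)
      exact ⟨b, fun n => hb _ ⟨n, rfl⟩⟩
    -- The least strict upper bound of the orbit `u` is closed under `F`: a point `b` below it
    -- satisfies `b ≤ u n < u (n + 1)` for some `n`, whence `F b < u (n + 2)`.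
    have hmin := WellFounded.min_mem (wellFounded_lt (α := α)) {b | ∀ n, u n < b} hbdd
    refine ⟨_, fun b hb => ?_, (hmin 0).le⟩
    have hb' : ∃ n, b ≤ u n := by
      by_contra! h
      exact WellFounded.not_lt_min (wellFounded_lt (α := α)) {b | ∀ n, u n < b} h hb
    obtain ⟨n, hn⟩ := hb'
    refine lt_trans (hgF (u (n + 1)) b (hn.trans_lt ?_)) ?_
    · rw [hu]; exact hg _
    · rw [← hu]; exact hmin _

/-- Two injections into a regular cardinal determine the same initial segments on a club. -/
theorem isClub_setOf_lt_iff_lt (hα : ℵ₀ < cof α) (hα' : ∀ a : α, #(Iio a) < cof α)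
    {W : Type u} {f g : W → α} (hf : f.Injective) (hg : g.Injective) :
    IsClub {a | ∀ w, f w < a ↔ g w < a} := by
  -- The two functions send `f w` to `g w` and back; points closed under both give the two
  -- implications.
  have h := (isClub_setOf_forall_lt hα hα' (Function.extend f g id)).inter hα.ne'
    (isClub_setOf_forall_lt hα hα' (Function.extend g f id))
  refine ⟨fun t ht _ _ a ha w => ?_, h.isCofinal.mono fun a ha w => ⟨fun hw => ?_, fun hw => ?_⟩⟩
  · simp_rw [lt_isLUB_iff ha]
    exact exists_congr fun b => and_congr_right fun hb => ht hb w
  · simpa [hf.extend_apply] using ha.1 _ hw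
  · simpa [hg.extend_apply] using ha.2 _ hw

end Club

section Gaps

variable {α V : Type*} [LinearOrder α]

/-- The indices of the intervals `[c n, c (n + 1))` which meet the image of `R` under `f`. -/
def gaps (f : V → α) (R : Set V) (c : ℕ → α) : Set ℕ :=
  {n | ∃ w ∈ R, c n ≤ f w ∧ f w < c (n + 1)}

/-- The intervals `[c n, c (n + 1))` are disjoint, so each point of `R \ R'` accounts for at most
one index. -/
theorem finite_gaps_diff (f : V → α) {R R' : Set V} {c : ℕ → α} (hc : Monotone c)
    (h : (R \ R').Finite) : (gaps f R c \ gaps f R' c).Finite := by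
  refine (h.biUnion (t := fun w => {n | c n ≤ f w ∧ f w < c (n + 1)}) fun w _ =>
    Set.Subsingleton.finite ?_).subset ?_
  · rintro m ⟨hm, hm'⟩ n ⟨hn, hn'⟩
    by_contra hne
    rcases Nat.lt_or_gt_of_ne hne with hlt | hlt
    · exact (hm'.trans_le ((hc hlt).trans hn)).false
    · exact (hn'.trans_le ((hc hlt).trans hm)).false
  · rintro n ⟨⟨w, hw, hn⟩, hn'⟩
    exact mem_biUnion (⟨hw, fun hw' => hn' ⟨w, hw', hn⟩⟩ : w ∈ R \ R') hn

theorem modFin_eq_iff {X Y : Set ℕ} : modFin X = modFin Y ↔ (X \ Y).Finite ∧ (Y \ X).Finite := by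
  rw [← finite_union]
  exact Quotient.eq (r := finSetoid)

theorem inter_ssubset_inter_iff (f : V → α) (R : Set V) {a b : α} (hab : a ≤ b) :
    R ∩ {v | f v < a} ⊂ R ∩ {v | f v < b} ↔ ∃ w ∈ R, a ≤ f w ∧ f w < b := by
  have h : R ∩ {v | f v < a} ⊆ R ∩ {v | f v < b} :=
    inter_subset_inter_right R fun v hv => lt_of_lt_of_le hv hab
  rw [Set.ssubset_iff_of_subset h]
  constructor
  · rintro ⟨w, ⟨hw, hwb⟩, hwa⟩
    exact ⟨w, hw, le_of_not_gt fun h => hwa ⟨hw, h⟩, hwb⟩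
  · rintro ⟨w, hw, hwa, hwb⟩
    exact ⟨w, ⟨hw, hwb⟩, fun h => hwa.not_gt h.2⟩

end Gaps

section Rays

variable {V : Type u}

theorem TailEquiv.finite_range_diff {x y : ℕ → V} (h : TailEquiv x y) :
    (range x \ range y).Finite := by
  obtain ⟨m, k, h⟩ := h
  refine ((Set.finite_Iio m).image x).subset ?_
  rintro _ ⟨⟨n, rfl⟩, hn⟩
  refine ⟨n, mem_Iio.2 (lt_of_not_ge fun hmn => hn ⟨k + (n - m), ?_⟩), rfl⟩
  rw [← h, Nat.add_sub_cancel' hmn]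

theorem TailEquiv.symm {x y : ℕ → V} : TailEquiv x y → TailEquiv y x :=
  fun ⟨m, k, h⟩ => ⟨k, m, fun n => (h n).symm⟩

theorem IsNbhdRay.map_coe {G : SimpleGraph V} {H : G.Subgraph} {v : H.verts} {x : ℕ → H.verts}
    (hx : IsNbhdRay H.coe v x) : IsNbhdRay G v fun n => (x n : V) :=
  ⟨⟨Subtype.val_injective.comp hx.1.1, fun n => H.adj_sub (hx.1.2 n)⟩, fun n => H.adj_sub (hx.2 n)⟩

end Rays

section Invariant

variable {V : Type u} {κ : Cardinal.{u}} {G : SimpleGraph V}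

theorem Parameters.phiVertex_eq (P : Parameters κ G) (C : ClubGuessing κ) (v : V)
    {δ : κ.ord.ToType} (hδ : δ ∈ C.S) :
    P.phiVertex C v δ = modFin (gaps P.h (P.r v) (C.c δ)) := by
  refine congrArg modFin (Set.ext fun n => ?_)
  exact inter_ssubset_inter_iff P.h (P.r v) ((C.strictMono δ hδ).monotone n.le_succ)

/-- The rays chosen at a vertex of an `r`-subgraph differ only in finitely many vertices. -/
theorem Parameters.finite_ray_diff (hG : InClass G) {H : G.Subgraph} (hr : IsRSubgraph H)
    (P : Parameters κ G) (Q : Parameters κ H.coe) (v : H.verts) :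
    (P.r v \ Subtype.val '' Q.r v).Finite ∧ (Subtype.val '' Q.r v \ P.r v).Finite := by
  by_cases h : HasNbhdRay G v
  · obtain ⟨x, hx, hPx⟩ := P.r_ray v h
    obtain ⟨y, hy, hQy⟩ := Q.r_ray v (hr v h)
    have hxy := hG v x _ hx hy.map_coe
    rw [hPx, hQy, ← range_comp]
    exact ⟨hxy.finite_range_diff, hxy.symm.finite_range_diff⟩
  · have h' : ¬ HasNbhdRay H.coe v := fun ⟨y, hy⟩ => h ⟨_, hy.map_coe⟩
    simp [P.r_empty v h, Q.r_empty v h']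

/-- Change the ray first, keeping the enumeration `P.h`, then the enumeration. The first change
costs finitely many indices, the second only indices below `m`. -/
theorem Parameters.phiVertex_coe_eq (hG : InClass G) {H : G.Subgraph} (hr : IsRSubgraph H)
    (P : Parameters κ G) (Q : Parameters κ H.coe) (C : ClubGuessing κ) (v : H.verts)
    {δ : κ.ord.ToType} (hδ : δ ∈ C.S) {m : ℕ}
    (hm : ∀ n, m ≤ n → ∀ w : H.verts, P.h w < C.c δ n ↔ Q.h w < C.c δ n) :
    P.phiVertex C v δ = Q.phiVertex C v δ := by
  rw [P.phiVertex_eq C v hδ, Q.phiVertex_eq C v hδ]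
  have hray := P.finite_ray_diff hG hr Q v
  have hmono := (C.strictMono δ hδ).monotone
  trans modFin (gaps P.h (Subtype.val '' Q.r v) (C.c δ))
  · exact modFin_eq_iff.2 ⟨finite_gaps_diff _ hmono hray.1, finite_gaps_diff _ hmono hray.2⟩
  · have key : ∀ n, m ≤ n → (n ∈ gaps P.h (Subtype.val '' Q.r v) (C.c δ) ↔
        n ∈ gaps Q.h (Q.r v) (C.c δ)) := by
      intro n hn
      simp only [gaps, mem_ofPred_eq, exists_mem_image]
      refine exists_congr fun w => and_congr_right fun _ => ?_
      rw [← not_lt, ← not_lt, hm n hn w, hm (n + 1) (hn.trans n.le_succ) w]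
    refine modFin_eq_iff.2 ⟨(Set.finite_Iio m).subset ?_, (Set.finite_Iio m).subset ?_⟩
    · exact fun n hn => lt_of_not_ge fun h => hn.2 ((key n h).1 hn.1)
    · exact fun n hn => lt_of_not_ge fun h => hn.2 ((key n h).2 hn.1)

end Invariant

section Ideal

variable {κ : Cardinal.{u}}

/-- Intersecting the witness for `Y` with `E` discards every `δ` for which no end segment of `c_δ`
lies in `E`. -/
theorem ClubGuessing.mem_idb_of_eventually {C : ClubGuessing κ} (hκ : cof κ.ord.ToType ≠ ℵ₀)
    {X Y E : Set κ.ord.ToType} (hE : IsClub E) (hY : Y ∈ C.idb)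
    (h : ∀ δ ∈ X, δ ∈ C.S → (∃ m, ∀ n, m ≤ n → C.c δ n ∈ E) → δ ∈ Y) : X ∈ C.idb := by
  obtain ⟨E', hE', hY⟩ := hY
  refine ⟨E ∩ E', hE.inter hκ hE', ?_⟩
  rintro δ ⟨⟨hX, hS⟩, hδ⟩ ⟨m, hm⟩
  exact hY δ ⟨⟨h δ hX hS ⟨m, fun n hn => (hm n hn).1⟩, hS⟩, hδ.2⟩ ⟨m, fun n hn => (hm n hn).2⟩

theorem ClubGuessing.iUnion_mem_idb {C : ClubGuessing κ} (hκ : cof κ.ord.ToType ≠ ℵ₀)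
    {ι : Type u} (hι : #ι < cof κ.ord.ToType) {X : ι → Set κ.ord.ToType}
    (hX : ∀ i, X i ∈ C.idb) : ⋃ i, X i ∈ C.idb := by
  choose E hE hX using hX
  refine ⟨⋂ i, E i, IsClub.iInter hκ (by simpa using hι) hE, ?_⟩
  rintro δ ⟨⟨hδ, hS⟩, hδE⟩ ⟨m, hm⟩
  obtain ⟨i, hi⟩ := mem_iUnion.1 hδ
  exact hX i δ ⟨⟨hi, hS⟩, mem_iInter.1 hδE i⟩ ⟨m, fun n hn => mem_iInter.1 (hm n hn) i⟩

end Ideal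

end RayGraph

/-- The family is indexed by a type `ι` of cardinality less than `κ`. It is only required to cover
the vertices of `G`, which holds in particular if `G` is the union of the `H i`. Each side of the
equation may be computed with arbitrary parameters; taking a single `H i`, equal to `G`, shows that
`Φ(G)` does not depend on the parameters. -/
theorem claim2p2 (κ : Cardinal.{u}) (hκ : κ.IsRegular) (hκ₁ : Cardinal.aleph 1 < κ)
    (C : RayGraph.ClubGuessing κ)
    {V : Type u} (G : SimpleGraph V) (hG : RayGraph.InClassCard κ G)
    {ι : Type u} (hι : Cardinal.mk ι < κ)
    (H : ι → G.Subgraph) (hH : ∀ i, RayGraph.InClassCard κ (H i).coe)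
    (hr : ∀ i, RayGraph.IsRSubgraph (H i))
    (hcover : ⋃ i, (H i).verts = Set.univ)
    (P : RayGraph.Parameters κ G) (Q : ∀ i, RayGraph.Parameters κ (H i).coe) :
    P.Phi C = ⋃ i, (Q i).Phi C := by
  have hcof : Order.cof κ.ord.ToType = κ := by rw [Ordinal.cof_toType, hκ.cof_ord]
  have hω : Cardinal.aleph0 < Order.cof κ.ord.ToType := by
    rw [hcof]; exact Cardinal.aleph0_lt_aleph_one.trans hκ₁
  have hIio (a : κ.ord.ToType) : Cardinal.mk (Set.Iio a) < Order.cof κ.ord.ToType := by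
    rw [hcof]; exact (Cardinal.mk_Iio_lt a (by simp)).trans_eq (by simp)
  let E (i : ι) : Set κ.ord.ToType := {a | ∀ w : (H i).verts, P.h w < a ↔ (Q i).h w < a}
  have hE (i : ι) : IsClub (E i) := RayGraph.isClub_setOf_lt_iff_lt hω hIio
    (P.h.injective.comp Subtype.val_injective) (Q i).h.injective
  have hphi (i : ι) (v : (H i).verts) {δ : κ.ord.ToType} (hδ : δ ∈ C.S)
      (h : ∃ m, ∀ n, m ≤ n → C.c δ n ∈ E i) :
      P.phiVertex C v δ = (Q i).phiVertex C v δ := by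
    obtain ⟨m, hm⟩ := h
    exact P.phiVertex_coe_eq hG.1 (hr i) (Q i) C v hδ hm
  ext A
  rw [Set.mem_iUnion]
  -- After negation both sides assert membership in the ideal.
  refine not_iff_not.1 ?_
  simp only [RayGraph.Parameters.Phi, Set.mem_ofPred_eq, not_exists, not_not]
  constructor
  · intro hA i
    refine RayGraph.ClubGuessing.mem_idb_of_eventually hω.ne' (hE i) hA ?_
    rintro δ ⟨hS, v, rfl⟩ _ hm
    exact ⟨hS, v, hphi i v hS hm⟩
  · intro hA
    -- The vertex realizing `A` may lie in any `H i`, so all the clubs `E i` are intersected.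
    refine RayGraph.ClubGuessing.mem_idb_of_eventually hω.ne'
      (IsClub.iInter hω.ne' (by simpa [hcof] using hι) hE)
      (RayGraph.ClubGuessing.iUnion_mem_idb hω.ne' (by rwa [hcof]) hA) ?_
    rintro δ ⟨hS, v, rfl⟩ _ ⟨m, hm⟩
    obtain ⟨i, hi⟩ := Set.mem_iUnion.1 (hcover ▸ Set.mem_univ v)
    exact Set.mem_iUnion.2 ⟨i, hS, ⟨v, hi⟩,
      (hphi i ⟨v, hi⟩ hS ⟨m, fun n hn => Set.mem_iInter.1 (hm n hn) i⟩).symm⟩
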